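/- Let $V$ be the rational vector space of all finitely supported sequences of rational numbers, with canonical basis $(e_k)_{k\in\mathbb N}$, and let $\mathcal P$ be the set of all pseudonorms on $V$ with the topology inherited from $\mathbb R^V$. Every $\mu\in\mathcal P$ extends uniquely to a pseudonorm, again denoted $\mu$, on the real vector space $c_{00}$ of finitely supported real sequences; $X_\mu$ denotes the (real) Banach space obtained as the completion of $(c_{00},\mu)/\{x:\mu(x)=0\}$. Let $\mathcal B\subseteq\mathcal P$, with the subspace topology, be the set of those $\mu$ for which $X_\mu$ is infinite-dimensional and the extension of $\mu$ to $c_{00}$ is a norm. For a separable Banach space $X$ let $\mathcal F(X)$ be the set of all nonempty closed subsets of $X$ and, for $U\subseteq X$ open, put $E^+(U)=\{F\in\mathcal F(X): F\cap U\neq\emptyset\}$. A Polish topology on $\mathcal F(X)$ is called admissible if (i) $E^+(U)$ is open for every open $U\subseteq X$, and (ii) it has a subbasis each member of which is a countable union of sets of the form $E^+(U)\setminus E^+(W)$ with $U,W\subseteq X$ open. A topology on the set $SB(X)\subseteq\mathcal F(X)$ of all closed linear subspaces of $X$ is called admissible if it is induced by an admissible topology on $\mathcal F(X)$. A map $f:A\to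 B$ between topological spaces is $\boldsymbol\Sigma^0_2$-measurable if $f^{-1}(U)$ is a countable union of closed sets for every open $U\subseteq B$. A Banach space is isometrically universal if every separable Banach space embeds into it linearly and isometrically. We write $Y\equiv Z$ if the Banach spaces $Y$ and $Z$ are linearly isometric (via a surjective linear isometry). Theorem. Let $X$ be an isometrically universal separable Banach space. (a) For every admissible topology $\tau$ on $SB(X)$ there is a $\boldsymbol\Sigma^0_2$-measurable map $\Phi:\mathcal B\to(SB(X),\tau)$ such that $X_\mu\equiv\Phi(\mu)$ for every $\mu\in\mathcal B$. (b) There are continuous maps $\chi_k:\mathcal B\to X$, $k\in\mathbb N$, such that $$\Big\|\sum_{k=1}^n a_k\chi_k(\nu)\Big\|=\nu\Big(\sum_{k=1}^n a_ke_k\Big)$$ for every $\sum_{k=1}^n a_ke_k\in c_{00}$ and every $\nu\in\mathcal B$. -/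

import Mathlib

noncomputable section

/-! ### The space of pseudonorms on the countable rational vector space -/

/-- The rational vector space `V` of all finitely supported sequences of rational numbers. -/
abbrev RatVec : Type := ℕ →₀ ℚ

/-- The real vector space `c₀₀` of all finitely supported sequences of real numbers. -/
abbrev RealVec : Type := ℕ →₀ ℝ

/-- The canonical embedding of `V` into `c₀₀`. -/
def ratToReal (v : RatVec) : RealVec := v.mapRange (fun q : ℚ => (q : ℝ)) Rat.cast_zero

/-- The space `𝓟` of all pseudonorms on the rational vector space `V`. -/
abbrev PseudonormSpace : Type := Seminorm ℚ RatVec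

/-- `𝓟` carries the topology inherited from the product `ℝ ^ V`. -/
instance : TopologicalSpace PseudonormSpace :=
  TopologicalSpace.induced (fun (μ : PseudonormSpace) (v : RatVec) => μ v) inferInstance

/-! ### Extension of a pseudonorm from `V` to `c₀₀` -/

theorem ratToReal_add (v w : RatVec) : ratToReal (v + w) = ratToReal v + ratToReal w := by
  ext i; simp [ratToReal]

theorem ratToReal_smul (q : ℚ) (v : RatVec) : ratToReal (q • v) = (q : ℝ) • ratToReal v := by
  ext i; simp [ratToReal]

theorem ratToReal_sub (v w : RatVec) : ratToReal (v - w) = ratToReal v - ratToReal w := by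
  ext i; simp [ratToReal]

/-- Auxiliary weighted `ℓ₁`-seminorm on `c₀₀`, an upper bound for the extension of `μ`. -/
def weightedSum (μ : PseudonormSpace) : Seminorm ℝ RealVec :=
  Seminorm.of (fun x => x.sum fun i a => |a| * μ (Finsupp.single i 1))
    (by
      intro x y
      classical
      have key : ∀ z : RealVec, z.support ⊆ x.support ∪ y.support →
          (z.sum fun i a => |a| * μ (Finsupp.single i 1)) =
            ∑ i ∈ x.support ∪ y.support, |z i| * μ (Finsupp.single i 1) :=
        fun z hz => Finsupp.sum_of_support_subset _ hz _ (by simp)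
      rw [key _ Finsupp.support_add, key x Finset.subset_union_left,
        key y Finset.subset_union_right, ← Finset.sum_add_distrib]
      refine Finset.sum_le_sum fun i _ => ?_
      rw [← add_mul]
      exact mul_le_mul_of_nonneg_right (by simpa using abs_add_le (x i) (y i))
        (apply_nonneg μ _))
    (by
      intro r x
      rw [Finsupp.sum_of_support_subset (s := x.support) _ Finsupp.support_smul _ (by simp),
        Finsupp.sum, Finset.mul_sum]
      refine Finset.sum_congr rfl fun i _ => ?_
      simp [abs_mul, mul_assoc])

theorem weightedSum_apply (μ : PseudonormSpace) (x : RealVec) :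
    weightedSum μ x = x.sum fun i a => |a| * μ (Finsupp.single i 1) := rfl

theorem le_weightedSum (μ : PseudonormSpace) (v : RatVec) :
    μ v ≤ weightedSum μ (ratToReal v) := by
  rw [weightedSum_apply, ratToReal, Finsupp.sum_mapRange_index (by simp)]
  conv_lhs => rw [← Finsupp.sum_single v]
  refine (Finset.le_sum_of_subadditive μ (map_zero μ).le (map_add_le_add μ) _ _).trans
    (Finset.sum_le_sum fun i _ => ?_)
  have h : Finsupp.single i (v i) = v i • Finsupp.single i (1 : ℚ) := by simp
  rw [h, map_smul_eq_mul]
  simp [← Rat.norm_cast_real]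

/-- Density of `V` in `c₀₀` with respect to every seminorm. -/
theorem exists_ratToReal_near (L : Seminorm ℝ RealVec) (x : RealVec) :
    ∀ ε : ℝ, 0 < ε → ∃ v : RatVec, L (x - ratToReal v) < ε := by
  induction x using Finsupp.induction_linear with
  | zero => exact fun ε hε => ⟨0, by simpa [ratToReal] using hε⟩
  | add f g hf hg =>
    intro ε hε
    obtain ⟨v, hv⟩ := hf (ε / 2) (by positivity)
    obtain ⟨w, hw⟩ := hg (ε / 2) (by positivity)
    refine ⟨v + w, ?_⟩
    have h : f + g - ratToReal (v + w) = (f - ratToReal v) + (g - ratToReal w) := by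
      rw [ratToReal_add]; abel
    rw [h]
    linarith [map_add_le_add L (f - ratToReal v) (g - ratToReal w)]
  | single i a =>
    intro ε hε
    have hL : 0 ≤ L (Finsupp.single i 1) := apply_nonneg L _
    obtain ⟨q, hq⟩ := Rat.denseRange_cast (𝕜 := ℝ) |>.exists_dist_lt a
      (show 0 < ε / (L (Finsupp.single i 1) + 1) by positivity)
    refine ⟨Finsupp.single i q, ?_⟩
    have h : Finsupp.single i a - ratToReal (Finsupp.single i q) =
        (a - q) • Finsupp.single i (1 : ℝ) := by
      ext j; by_cases hj : i = j <;> simp [ratToReal, hj]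
    rw [h, map_smul_eq_mul, Real.norm_eq_abs]
    rw [Real.dist_eq, lt_div_iff₀ (by positivity)] at hq
    nlinarith [abs_nonneg (a - q)]

/-- Every pseudonorm on `V` extends to exactly one (real) pseudonorm on `c₀₀`. -/
theorem existsUnique_extension (μ : PseudonormSpace) :
    ∃! p : Seminorm ℝ RealVec, ∀ v : RatVec, p (ratToReal v) = μ v := by
  set L := weightedSum μ with hLdef
  let f : RealVec → ℝ := fun x => ⨅ v : RatVec, μ v + L (x - ratToReal v)
  have bdd : ∀ x, BddBelow (Set.range fun v : RatVec => μ v + L (x - ratToReal v)) := by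
    intro x
    refine ⟨0, ?_⟩
    rintro _ ⟨v, rfl⟩
    exact add_nonneg (apply_nonneg μ _) (apply_nonneg L _)
  have f_le : ∀ x v, f x ≤ μ v + L (x - ratToReal v) := fun x v => ciInf_le (bdd x) v
  have le_f : ∀ x c, (∀ v, c ≤ μ v + L (x - ratToReal v)) → c ≤ f x := fun x c h => le_ciInf h
  have f_add : ∀ x y, f (x + y) ≤ f x + f y := by
    intro x y
    have h1 : ∀ w, f (x + y) - (μ w + L (y - ratToReal w)) ≤ f x := by
      intro w
      refine le_f _ _ fun v => ?_
      have h := f_le (x + y) (v + w)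
      have e : x + y - ratToReal (v + w) = (x - ratToReal v) + (y - ratToReal w) := by
        rw [ratToReal_add]; abel
      rw [e] at h
      linarith [map_add_le_add L (x - ratToReal v) (y - ratToReal w), map_add_le_add μ v w]
    have h2 : f (x + y) - f x ≤ f y := le_f _ _ fun w => by linarith [h1 w]
    linarith
  have f_L : ∀ x, f x ≤ L x := by
    intro x
    simpa [ratToReal] using f_le x 0
  have f_rat : ∀ v, f (ratToReal v) = μ v := by
    intro v
    refine le_antisymm (by simpa using f_le (ratToReal v) v) (le_f _ _ fun w => ?_)
    have h := le_weightedSum μ (v - w)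
    rw [ratToReal_sub] at h
    have h2 := map_add_le_add μ w (v - w)
    rw [add_sub_cancel] at h2
    linarith
  have f_near : ∀ x v, |f x - f (ratToReal v)| ≤ L (x - ratToReal v) := by
    intro x v
    rw [abs_le]
    have h1 := f_add (ratToReal v) (x - ratToReal v)
    have h2 := f_add x (ratToReal v - x)
    have h3 := f_L (x - ratToReal v)
    have h4 := f_L (ratToReal v - x)
    rw [map_sub_rev] at h4
    rw [add_sub_cancel] at h1 h2
    constructor <;> linarith
  have f_zero : f 0 = 0 := by
    have h := f_rat 0
    simpa [ratToReal] using h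
  have f_smul_le : ∀ (r : ℝ) x, f (r • x) ≤ ‖r‖ * f x := by
    intro r x
    refine le_of_forall_pos_le_add fun ε hε => ?_
    obtain ⟨v, hv⟩ := exists_ratToReal_near L x (ε / (4 * (|r| + 1))) (by positivity)
    have hμv : 0 ≤ μ v := apply_nonneg μ v
    have hLv : 0 ≤ L (ratToReal v) := apply_nonneg L _
    have hLx : 0 ≤ L (x - ratToReal v) := apply_nonneg L _
    obtain ⟨q, hq⟩ := Rat.denseRange_cast (𝕜 := ℝ) |>.exists_dist_lt r
      (show 0 < ε / (4 * (μ v + L (ratToReal v) + 1)) by positivity)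
    rw [Real.dist_eq, lt_div_iff₀ (by positivity)] at hq
    rw [lt_div_iff₀ (by positivity)] at hv
    have hqr : |(q : ℝ)| ≤ |r| + |r - q| := by
      have h := abs_sub r (r - q)
      rwa [sub_sub_cancel] at h
    have h1 : f (ratToReal (q • v)) = |(q : ℝ)| * μ v := by
      rw [f_rat, map_smul_eq_mul]; simp [← Rat.norm_cast_real]
    have h2 : f (r • x) ≤ f (ratToReal (q • v)) + f (r • x - ratToReal (q • v)) := by
      have h := f_add (ratToReal (q • v)) (r • x - ratToReal (q • v))
      rwa [add_sub_cancel] at h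
    have e : r • x - ratToReal (q • v) = r • (x - ratToReal v) + (r - (q : ℝ)) • ratToReal v := by
      rw [ratToReal_smul, smul_sub, sub_smul]; abel
    have h3 : f (r • x - ratToReal (q • v)) ≤
        |r| * L (x - ratToReal v) + |r - q| * L (ratToReal v) := by
      refine (f_L _).trans ?_
      rw [e]
      refine (map_add_le_add L _ _).trans ?_
      rw [map_smul_eq_mul, map_smul_eq_mul, Real.norm_eq_abs, Real.norm_eq_abs]
    have h4 := f_near x v
    rw [f_rat, abs_le] at h4
    have h5 : |(q : ℝ)| * μ v ≤ (|r| + |r - q|) * μ v := mul_le_mul_of_nonneg_right hqr hμv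
    have h6 : |r| * μ v ≤ |r| * (f x + L (x - ratToReal v)) :=
      mul_le_mul_of_nonneg_left (by linarith) (abs_nonneg r)
    rw [Real.norm_eq_abs]
    have h7 := abs_nonneg (r - q)
    have h8 := abs_nonneg r
    nlinarith
  refine ⟨Seminorm.ofSMulLE f f_zero f_add f_smul_le, fun v => f_rat v, ?_⟩
  intro p hp
  have main : ∀ p₁ p₂ : Seminorm ℝ RealVec, (∀ v, p₁ (ratToReal v) = μ v) →
      (∀ v, p₂ (ratToReal v) = μ v) → ∀ x, p₁ x ≤ p₂ x := by
    intro p₁ p₂ h₁ h₂ x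
    refine le_of_forall_pos_le_add fun ε hε => ?_
    obtain ⟨v, hv⟩ := exists_ratToReal_near (p₁ + p₂) x ε hε
    rw [add_apply] at hv
    have a1 := map_add_le_add p₁ (ratToReal v) (x - ratToReal v)
    have a2 := map_add_le_add p₂ x (ratToReal v - x)
    rw [add_sub_cancel] at a1 a2
    rw [map_sub_rev] at a2
    rw [h₁] at a1
    rw [h₂] at a2
    linarith
  ext x
  exact le_antisymm (main _ _ hp f_rat x) (main _ _ f_rat hp x)

/-- The extension of the pseudonorm `μ` on `V` to a pseudonorm on `c₀₀`: the unique real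
seminorm on `c₀₀` which agrees with `μ` on `V`. -/
def extendNorm (μ : PseudonormSpace) : Seminorm ℝ RealVec :=
  (existsUnique_extension μ).choose

theorem extendNorm_ratToReal (μ : PseudonormSpace) (v : RatVec) :
    extendNorm μ (ratToReal v) = μ v :=
  (existsUnique_extension μ).choose_spec.1 v

theorem extendNorm_unique (μ : PseudonormSpace) (p : Seminorm ℝ RealVec)
    (hp : ∀ v, p (ratToReal v) = μ v) : p = extendNorm μ :=
  (existsUnique_extension μ).choose_spec.2 p hp

/-! ### The Banach space coded by a pseudonorm -/

/-- A copy of `c₀₀` to be equipped with the pseudonorm `μ`. -/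
def PreSpace (_μ : PseudonormSpace) : Type := RealVec

instance (μ : PseudonormSpace) : AddCommGroup (PreSpace μ) :=
  inferInstanceAs (AddCommGroup RealVec)

instance (μ : PseudonormSpace) : Module ℝ (PreSpace μ) :=
  inferInstanceAs (Module ℝ RealVec)

instance (μ : PseudonormSpace) : SeminormedAddCommGroup (PreSpace μ) :=
  AddGroupSeminorm.toSeminormedAddCommGroup (E := PreSpace μ) (extendNorm μ).toAddGroupSeminorm

instance (μ : PseudonormSpace) : NormedSpace ℝ (PreSpace μ) where
  norm_smul_le r x := (map_smul_eq_mul (extendNorm μ) r x).le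

theorem PreSpace.norm_def (μ : PseudonormSpace) (x : PreSpace μ) : ‖x‖ = extendNorm μ x := rfl

/-- The Banach space `X_μ`. Mathlib's `UniformSpace.Completion` of a seminormed space is the
Hausdorff completion, i.e. the completion of the quotient by the null space of the pseudonorm. -/
abbrev CodedSpace (μ : PseudonormSpace) : Type := UniformSpace.Completion (PreSpace μ)

/-- The set `𝓟_∞` of pseudonorms coding an infinite-dimensional Banach space. -/
def infDimPseudonorms : Set PseudonormSpace :=
  {μ | ¬ FiniteDimensional ℝ (CodedSpace μ)}

/-- The space of norms `𝓑`: those `μ ∈ 𝓟_∞` whose extension to `c₀₀` is an actual norm. It is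
used below as a subtype, with the topology inherited from `𝓟`. -/
def normSpace : Set PseudonormSpace :=
  {μ | μ ∈ infDimPseudonorms ∧ ∀ x : RealVec, extendNorm μ x = 0 → x = 0}

/-! ### Admissible topologies -/

/-- The set `𝓕(X)` of all nonempty closed subsets of `X`. -/
abbrev ClosedSets (X : Type*) [TopologicalSpace X] : Type _ :=
  {F : Set X // IsClosed F ∧ F.Nonempty}

/-- `E⁺(U)`: the closed sets that meet `U`. -/
def hitSet {X : Type*} [TopologicalSpace X] (U : Set X) : Set (ClosedSets X) :=
  {F | (U ∩ F.1).Nonempty}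

/-- Admissible topologies on `𝓕(X)`. -/
structure IsAdmissible {X : Type*} [TopologicalSpace X]
    (σ : TopologicalSpace (ClosedSets X)) : Prop where
  polish : @PolishSpace (ClosedSets X) σ
  isOpen_hitSet : ∀ U : Set X, IsOpen U → @IsOpen _ σ (hitSet U)
  exists_subbasis : ∃ S : Set (Set (ClosedSets X)), σ = TopologicalSpace.generateFrom S ∧
    ∀ s ∈ S, ∃ U W : ℕ → Set X, (∀ n, IsOpen (U n)) ∧ (∀ n, IsOpen (W n)) ∧
      s = ⋃ n, hitSet (U n) \ hitSet (W n)

/-- The set `SB(X)` of all closed linear subspaces of `X`. -/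
abbrev SB (X : Type*) [NormedAddCommGroup X] [NormedSpace ℝ X] : Type _ := ClosedSubmodule ℝ X

/-- The inclusion of `SB(X)` into `𝓕(X)`. -/
def SB.toClosedSets {X : Type*} [NormedAddCommGroup X] [NormedSpace ℝ X] (Y : SB X) :
    ClosedSets X :=
  ⟨(Y : Set X), Y.isClosed', ⟨0, Y.toSubmodule.zero_mem⟩⟩

/-- Admissible topologies on `SB(X)`: those induced by an admissible topology on `𝓕(X)`. -/
def IsAdmissibleSB {X : Type*} [NormedAddCommGroup X] [NormedSpace ℝ X]
    (τ : TopologicalSpace (SB X)) : Prop :=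
  ∃ σ : TopologicalSpace (ClosedSets X), IsAdmissible σ ∧
    τ = TopologicalSpace.induced SB.toClosedSets σ

/-! ### Universal spaces and `Σ⁰₂`-measurable maps -/

/-- `X` is isometrically universal (for separable Banach spaces): every separable Banach space
embeds linearly and isometrically into `X`. Each separable Banach space has at most continuum many
points and is therefore isometric to one whose underlying type lives in `Type`. -/
def IsometricallyUniversal (X : Type*) [NormedAddCommGroup X] [NormedSpace ℝ X] : Prop :=
  ∀ (Y : Type) [NormedAddCommGroup Y] [NormedSpace ℝ Y] [CompleteSpace Y]
    [TopologicalSpace.SeparableSpace Y], Nonempty (Y →ₗᵢ[ℝ] X)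

/-- The class `Σ⁰₂`: countable unions of closed sets. -/
def IsSigmaTwo {A : Type*} [TopologicalSpace A] (s : Set A) : Prop :=
  ∃ F : ℕ → Set A, (∀ n, IsClosed (F n)) ∧ s = ⋃ n, F n

/-- `Σ⁰₂`-measurable maps; the topology on the target is an explicit argument. -/
def SigmaTwoMeasurable {A B : Type*} [TopologicalSpace A] (τ : TopologicalSpace B)
    (f : A → B) : Prop :=
  ∀ U : Set B, @IsOpen B τ U → IsSigmaTwo (f ⁻¹' U)

end

/-!
Since `X` is isometrically universal, continuous copies of all the spaces `(c₀₀, μ)`, `μ ∈ 𝓑`, have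
to be found only in some separable Banach space, which then embeds into `X`. Every `(c₀₀, μ)` embeds
isometrically into the bounded functions on its dual ball by evaluation. To obtain functions on a
domain that does not depend on `μ`, the dual balls are placed in the Hilbert space `ℓ²`, with the
value of a functional at `e_k` rescaled by `4⁻ᵏ / μ (e_k)` (`dualBall`), and the evaluations are
composed with the nearest point map from a fixed ball of `ℓ²` onto the dual ball (`basisImage`).
The embedding stays isometric because the nearest point map fixes the dual ball.

Continuity in `μ` has two ingredients. On the span of finitely many basis vectors a norm is
multiplicatively close to all nearby pseudonorms, by compactness of the unit sphere
(`eventually_extendNorm_le_mul`), so by the Hahn–Banach theorem `dualBall μ` varies continuously in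
the Hausdorff distance (`eventually_dualBall_near`); this is where it matters that `μ` is a norm.
And in a Hilbert space the nearest point in a closed convex set moves by `O(√δ)` when the set moves
by `δ` in the Hausdorff distance (`norm_sub_sq_le_of_variational`). As `𝓑` is second countable, the
continuous maps obtained have values in one separable space.

For the selector, `Φ μ` is the closed span of the vectors `χ_k(μ)`. It meets an open set `U` if and
only if a rational combination of these vectors lies in `U`, which is an open condition on `μ`. Sets
`E⁺(U) \ E⁺(W)` thus have `Σ⁰₂` preimages, and `IsAdmissible.sigmaTwoMeasurable` passes to all open
sets of an admissible topology.
-/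

open Filter Topology
open scoped InnerProductSpace

/-! ### Continuity of the extension in the pseudonorm and the vector -/

theorem continuous_pseudonorm_apply (v : RatVec) : Continuous fun μ : PseudonormSpace => μ v :=
  (continuous_apply v).comp continuous_induced_dom

theorem extendNorm_single_one (μ : PseudonormSpace) (k : ℕ) :
    extendNorm μ (Finsupp.single k 1) = μ (Finsupp.single k 1) := by
  rw [← extendNorm_ratToReal]
  simp [ratToReal]

/-- The inclusion of `ℝⁿ` into `c₀₀` as the span of the first `n` basis vectors. -/
noncomputable def initialVec (n : ℕ) : (Fin n → ℝ) →ₗ[ℝ] RealVec :=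
  ∑ i : Fin n, (Finsupp.lsingle (i : ℕ)).comp (LinearMap.proj i)

theorem initialVec_apply {n : ℕ} (a : Fin n → ℝ) :
    initialVec n a = ∑ i : Fin n, Finsupp.single (i : ℕ) (a i) := by
  simp [initialVec]

theorem initialVec_coe {n : ℕ} (a : Fin n → ℝ) (i : Fin n) : initialVec n a i = a i := by
  rw [initialVec_apply, Finsupp.finsetSum_apply, Finset.sum_eq_single i]
  · simp
  · intro j _ hj
    exact Finsupp.single_eq_of_ne (fun h => hj (Fin.ext h.symm))
  · simp

theorem initialVec_injective (n : ℕ) : Function.Injective (initialVec n) := fun a b h => by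
  ext i
  rw [← initialVec_coe a i, h, initialVec_coe]

theorem initialVec_surjOn_supported {n : ℕ} {x : RealVec}
    (hx : x ∈ Finsupp.supported ℝ ℝ (Set.Iio n)) : ∃ a, initialVec n a = x := by
  refine ⟨fun i => x i, ?_⟩
  ext k
  by_cases hk : k < n
  · exact initialVec_coe _ ⟨k, hk⟩
  · have h1 : x k = 0 := by
      by_contra h
      exact hk (hx (Finsupp.mem_support_iff.2 h))
    rw [h1, initialVec_apply, Finsupp.finsetSum_apply]
    refine Finset.sum_eq_zero fun i _ => Finsupp.single_eq_of_ne fun h => hk (h ▸ i.2)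

theorem extendNorm_initialVec_le (μ : PseudonormSpace) {n : ℕ} {a : Fin n → ℝ} {δ : ℝ}
    (ha : ∀ i, |a i| ≤ δ) :
    extendNorm μ (initialVec n a) ≤ δ * ∑ i : Fin n, μ (Finsupp.single (i : ℕ) 1) := by
  rw [initialVec_apply, Finset.mul_sum]
  refine (Finset.le_sum_of_subadditive _ (map_zero _).le (map_add_le_add _) _ _).trans
    (Finset.sum_le_sum fun i _ => ?_)
  have h : Finsupp.single (i : ℕ) (a i) = a i • Finsupp.single (i : ℕ) (1 : ℝ) := by simp
  rw [h, map_smul_eq_mul, extendNorm_single_one]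
  exact mul_le_mul_of_nonneg_right (ha i) (apply_nonneg μ _)

/-- On a finite-dimensional subspace the value of the pseudonorm depends jointly continuously on
the pseudonorm and the vector: rational vectors are dense, and the Lipschitz constants are locally
bounded in the pseudonorm. -/
theorem continuous_extendNorm_initialVec (n : ℕ) :
    Continuous fun p : PseudonormSpace × (Fin n → ℝ) => extendNorm p.1 (initialVec n p.2) := by
  rw [continuous_iff_continuousAt]
  rintro ⟨μ, a⟩
  rw [ContinuousAt, Metric.tendsto_nhds]
  intro ε hε
  let S : PseudonormSpace → ℝ := fun ν => ∑ i : Fin n, ν (Finsupp.single (i : ℕ) 1)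
  have hS : Continuous S := continuous_finsetSum _ fun i _ => continuous_pseudonorm_apply _
  have hS0 : ∀ ν, 0 ≤ S ν := fun ν => Finset.sum_nonneg fun i _ => apply_nonneg ν _
  set δ := ε / (4 * (S μ + 1)) with hδdef
  have hS0' := hS0 μ
  have hδ : 0 < δ := by positivity
  have hδS : δ * (S μ + 1) = ε / 4 := by rw [hδdef]; field_simp
  choose q hq using fun i => Rat.denseRange_cast (𝕜 := ℝ) |>.exists_dist_lt (a i) hδ
  let v : RatVec := ∑ i : Fin n, Finsupp.single (i : ℕ) (q i)
  have hv : ratToReal v = initialVec n fun i => (q i : ℝ) := by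
    have h : ∀ w, ratToReal w = Finsupp.mapRange.addMonoidHom (Rat.castHom ℝ).toAddMonoidHom w :=
      fun w => rfl
    rw [initialVec_apply, h, map_sum]
    refine Finset.sum_congr rfl fun i _ => ?_
    rw [← h]
    simp [ratToReal]
  have key : ∀ (ν : PseudonormSpace) (b : Fin n → ℝ), (∀ i, |b i - q i| ≤ δ) →
      |extendNorm ν (initialVec n b) - ν v| ≤ δ * S ν := by
    intro ν b hb
    rw [← extendNorm_ratToReal, hv]
    refine (abs_sub_map_le_sub _ _ _).trans ?_
    rw [← map_sub]
    exact extendNorm_initialVec_le ν hb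
  have e1 : ∀ᶠ p : PseudonormSpace × (Fin n → ℝ) in 𝓝 (μ, a), S p.1 < S μ + 1 :=
    (hS.comp continuous_fst).continuousAt.eventually_lt_const (by simp)
  have e2 : ∀ᶠ p : PseudonormSpace × (Fin n → ℝ) in 𝓝 (μ, a), ∀ i, |p.2 i - q i| < δ := by
    rw [eventually_all]
    intro i
    have hc : Continuous fun p : PseudonormSpace × (Fin n → ℝ) => |p.2 i - q i| := by fun_prop
    exact hc.continuousAt.eventually_lt_const (by simpa [Real.dist_eq] using hq i)
  have e3 : ∀ᶠ p : PseudonormSpace × (Fin n → ℝ) in 𝓝 (μ, a), |p.1 v - μ v| < ε / 4 := by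
    have hc : Continuous fun p : PseudonormSpace × (Fin n → ℝ) => |p.1 v - μ v| :=
      (((continuous_pseudonorm_apply v).comp continuous_fst).sub continuous_const).abs
    exact hc.continuousAt.eventually_lt_const (by simpa using by positivity)
  filter_upwards [e1, e2, e3] with p h1 h2 h3
  have k1 := key p.1 p.2 fun i => (h2 i).le
  have k2 := key μ a fun i => by simpa [Real.dist_eq] using (hq i).le
  have k3 : δ * S p.1 ≤ ε / 4 := by rw [← hδS]; gcongr
  have k4 : δ * S μ ≤ ε / 4 := by rw [← hδS]; gcongr; linarith
  rw [Real.dist_eq]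
  rw [abs_le] at k1 k2
  rw [abs_lt] at h3 ⊢
  constructor <;> linarith [k1.1, k1.2, k2.1, k2.2, h3.1, h3.2]

/-- If `μ` is a norm, then pseudonorms near `μ` are multiplicatively close to `μ` on the span of
the first `n` basis vectors, because the unit sphere of that span is compact and `μ` is positive
on it. -/
theorem eventually_extendNorm_le_mul {μ : PseudonormSpace}
    (hμ : ∀ x, extendNorm μ x = 0 → x = 0) (n : ℕ) {r : ℝ} (hr : 1 < r) :
    ∀ᶠ ν in 𝓝 μ, ∀ x ∈ Finsupp.supported ℝ ℝ (Set.Iio n),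
      extendNorm ν x ≤ r * extendNorm μ x ∧ extendNorm μ x ≤ r * extendNorm ν x := by
  have hc := continuous_extendNorm_initialVec n
  have h0 : ∀ᶠ ν in 𝓝 μ, ∀ a ∈ Metric.sphere (0 : Fin n → ℝ) 1,
      extendNorm ν (initialVec n a) < r * extendNorm μ (initialVec n a) ∧
        extendNorm μ (initialVec n a) < r * extendNorm ν (initialVec n a) := by
    refine (isCompact_sphere _ _).eventually_forall_of_forall_eventually fun a ha => ?_
    have hpos : 0 < extendNorm μ (initialVec n a) := by
      refine (apply_nonneg _ _).lt_of_ne' fun h => ?_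
      have ha0 : a = 0 := initialVec_injective n ((hμ _ h).trans (map_zero _).symm)
      simp [ha0] at ha
    have hc' : Continuous fun p : PseudonormSpace × (Fin n → ℝ) =>
        extendNorm μ (initialVec n p.2) := by
      exact hc.comp (continuous_const.prodMk continuous_snd)
    refine (hc.continuousAt.eventually_lt (hc'.const_mul r).continuousAt ?_).and
      (hc'.continuousAt.eventually_lt (hc.const_mul r).continuousAt ?_)
    all_goals
      dsimp only
      nlinarith
  filter_upwards [h0] with ν hν x hx
  obtain ⟨a, rfl⟩ := initialVec_surjOn_supported hx
  rcases eq_or_ne a 0 with rfl | ha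
  · simp
  have ha' : 0 < ‖a‖ := norm_pos_iff.2 ha
  have h1 := hν (‖a‖⁻¹ • a) (by simp [norm_smul, ha'.ne'])
  rw [map_smul, map_smul_eq_mul, map_smul_eq_mul, norm_inv, norm_norm, mul_left_comm r,
    mul_left_comm r, mul_lt_mul_iff_right₀ (inv_pos.2 ha'),
    mul_lt_mul_iff_right₀ (inv_pos.2 ha')] at h1
  exact ⟨h1.1.le, h1.2.le⟩

/-! ### Dual balls as convex subsets of a Hilbert space -/

/-- The Hilbert space `ℓ²`. -/
abbrev EllTwo : Type := lp (fun _ : ℕ => ℝ) 2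

theorem EllTwo.continuous_coe (k : ℕ) : Continuous fun x : EllTwo => x k :=
  (LipschitzWith.of_dist_le_mul (K := 1) fun x y => by
    simpa [dist_eq_norm] using lp.norm_apply_le_norm (by norm_num) (x - y) k).continuous

theorem abs_sq_le_of_geometric {x : ℕ → ℝ} {δ : ℝ} (hx : ∀ k, |x k| ≤ δ * (1 / 2) ^ k) (k : ℕ) :
    ‖x k‖ ^ (2 : ENNReal).toReal ≤ δ ^ 2 * (1 / 4) ^ k := by
  have h : (1 / 4 : ℝ) ^ k = ((1 / 2) ^ k) ^ 2 := by rw [← pow_mul, mul_comm, pow_mul]; norm_num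
  rw [h, ← mul_pow]
  simpa using pow_le_pow_left₀ (abs_nonneg _) (hx k) 2

theorem memℓp_two_of_geometric {x : ℕ → ℝ} {δ : ℝ} (hx : ∀ k, |x k| ≤ δ * (1 / 2) ^ k) :
    Memℓp x 2 :=
  memℓp_gen <| Summable.of_nonneg_of_le (fun _ => by positivity) (abs_sq_le_of_geometric hx)
    ((summable_geometric_of_lt_one (by norm_num) (by norm_num)).mul_left _)

theorem EllTwo.norm_le_of_geometric {x : EllTwo} {δ : ℝ} (hδ : 0 ≤ δ)
    (hx : ∀ k, |x k| ≤ δ * (1 / 2) ^ k) : ‖x‖ ≤ 2 * δ := by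
  refine lp.norm_le_of_tsum_le (by norm_num) (by positivity) ?_
  have h : HasSum (fun k : ℕ => δ ^ 2 * (1 / 4 : ℝ) ^ k) (δ ^ 2 * (1 - 1 / 4)⁻¹) :=
    (hasSum_geometric_of_lt_one (by norm_num) (by norm_num)).mul_left _
  refine (Summable.tsum_le_tsum (abs_sq_le_of_geometric hx)
    ((lp.memℓp x).summable (by norm_num)) h.summable).trans ?_
  rw [h.tsum_eq]
  norm_num
  nlinarith [sq_nonneg δ]

/-- The weight of the `k`-th coordinate: a functional `f` is encoded by the sequence
`f (e_k) / coordWeight μ k`, which is bounded by `4⁻ᵏ` if `f` lies in the dual ball of `μ`. -/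
noncomputable def coordWeight (μ : PseudonormSpace) (k : ℕ) : ℝ := 4 ^ k * μ (Finsupp.single k 1)

/-- The functional `f` on `c₀₀` encoded by `x`, so that `f (e_k) = coordWeight μ k * x k`. -/
noncomputable def coordFunctional (μ : PseudonormSpace) (x : ℕ → ℝ) : RealVec →ₗ[ℝ] ℝ :=
  Finsupp.linearCombination ℝ fun k => coordWeight μ k * x k

theorem coordFunctional_apply (μ : PseudonormSpace) (x : ℕ → ℝ) (a : RealVec) :
    coordFunctional μ x a = a.sum fun k c => c * (coordWeight μ k * x k) :=
  rfl

theorem coordFunctional_single (μ : PseudonormSpace) (x : ℕ → ℝ) (k : ℕ) :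
    coordFunctional μ x (Finsupp.single k 1) = coordWeight μ k * x k := by
  simp [coordFunctional]

/-- The unit ball of the dual of `(c₀₀, μ)`, placed in `ℓ²` by rescaling the coordinates. -/
def dualBall (μ : PseudonormSpace) : Set EllTwo :=
  {x | ∀ a, |coordFunctional μ x a| ≤ extendNorm μ a}

theorem zero_mem_dualBall (μ : PseudonormSpace) : (0 : EllTwo) ∈ dualBall μ := fun a => by
  have h : coordFunctional μ (0 : EllTwo) a = 0 := by
    rw [coordFunctional_apply]
    exact Finset.sum_eq_zero fun k _ => by simp
  rw [h, abs_zero]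
  exact apply_nonneg _ _

theorem convex_dualBall (μ : PseudonormSpace) : Convex ℝ (dualBall μ) := by
  intro x hx y hy s t hs ht hst a
  have h : coordFunctional μ (s • x + t • y : EllTwo) a =
      s * coordFunctional μ x a + t * coordFunctional μ y a := by
    simp only [coordFunctional_apply, Finsupp.sum, Finset.mul_sum, ← Finset.sum_add_distrib]
    refine Finset.sum_congr rfl fun k _ => ?_
    change a k * (coordWeight μ k * (s * x k + t * y k)) = _
    ring
  rw [h]
  refine (abs_add_le _ _).trans ?_
  rw [abs_mul, abs_mul, abs_of_nonneg hs, abs_of_nonneg ht]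
  calc s * |coordFunctional μ x a| + t * |coordFunctional μ y a|
      ≤ s * extendNorm μ a + t * extendNorm μ a := 
        add_le_add (mul_le_mul_of_nonneg_left (hx a) hs) (mul_le_mul_of_nonneg_left (hy a) ht)
    _ = extendNorm μ a := by rw [← add_mul, hst, one_mul]

theorem isClosed_dualBall (μ : PseudonormSpace) : IsClosed (dualBall μ) := by
  rw [dualBall, Set.ofPred_forall]
  refine isClosed_iInter fun a => isClosed_le (Continuous.abs ?_) continuous_const
  simp only [coordFunctional_apply, Finsupp.sum]
  exact continuous_finsetSum _ fun k _ =>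
    continuous_const.mul (continuous_const.mul (EllTwo.continuous_coe k))

theorem coordWeight_pos {μ : PseudonormSpace} (hμ : ∀ x, extendNorm μ x = 0 → x = 0) (k : ℕ) :
    0 < coordWeight μ k := by
  refine mul_pos (by positivity) ((apply_nonneg μ _).lt_of_ne' fun h => ?_)
  rw [← extendNorm_single_one] at h
  simpa using hμ _ h

theorem abs_coord_le_of_coordWeight_mul_le {μ : PseudonormSpace}
    (hμ : ∀ x, extendNorm μ x = 0 → x = 0) {t : ℝ} {k : ℕ}
    (h : |coordWeight μ k * t| ≤ extendNorm μ (Finsupp.single k 1)) : |t| ≤ (1 / 4) ^ k := by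
  have hw := coordWeight_pos hμ k
  rw [abs_mul, abs_of_pos hw, extendNorm_single_one] at h
  refine le_of_mul_le_mul_left (h.trans_eq ?_) hw
  rw [coordWeight, mul_right_comm, ← mul_pow]
  norm_num

theorem abs_coord_le_of_mem_dualBall {μ : PseudonormSpace}
    (hμ : ∀ x, extendNorm μ x = 0 → x = 0) {x : EllTwo} (hx : x ∈ dualBall μ) (k : ℕ) :
    |x k| ≤ (1 / 4) ^ k := by
  refine abs_coord_le_of_coordWeight_mul_le hμ ?_
  rw [← coordFunctional_single]
  exact hx _

theorem quarter_pow_le_half_pow (k : ℕ) : (1 / 4 : ℝ) ^ k ≤ (1 / 2) ^ k :=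
  pow_le_pow_left₀ (by norm_num) (by norm_num) k

theorem norm_le_two_of_mem_dualBall {μ : PseudonormSpace}
    (hμ : ∀ x, extendNorm μ x = 0 → x = 0) {x : EllTwo} (hx : x ∈ dualBall μ) : ‖x‖ ≤ 2 := by
  have h := EllTwo.norm_le_of_geometric (x := x) zero_le_one fun k => by
    rw [one_mul]
    exact (abs_coord_le_of_mem_dualBall hμ hx k).trans (quarter_pow_le_half_pow k)
  simpa using h

/-- Every functional dominated by the norm `μ` is represented by a point of the dual ball. -/
theorem exists_mem_dualBall_coordFunctional_eq {μ : PseudonormSpace}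
    (hμ : ∀ x, extendNorm μ x = 0 → x = 0) (f : RealVec →ₗ[ℝ] ℝ)
    (hf : ∀ a, f a ≤ extendNorm μ a) : ∃ x ∈ dualBall μ, coordFunctional μ x = f := by
  have hf' : ∀ a, |f a| ≤ extendNorm μ a := fun a => abs_le.2
    ⟨by have h := hf (-a); rw [map_neg, map_neg_eq_map] at h; linarith, hf a⟩
  let x : ℕ → ℝ := fun k => (coordWeight μ k)⁻¹ * f (Finsupp.single k 1)
  have hw : ∀ k, coordWeight μ k * x k = f (Finsupp.single k 1) := fun k =>
    mul_inv_cancel_left₀ (coordWeight_pos hμ k).ne' _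
  have hx : ∀ k, |x k| ≤ 1 * (1 / 2) ^ k := fun k => by
    rw [one_mul]
    refine (abs_coord_le_of_coordWeight_mul_le hμ ?_).trans (quarter_pow_le_half_pow k)
    rw [hw]
    exact hf' _
  have hfx : coordFunctional μ x = f := by
    refine Finsupp.lhom_ext' fun k => LinearMap.ext_ring ?_
    exact (coordFunctional_single μ x k).trans (hw k)
  exact ⟨⟨x, memℓp_two_of_geometric hx⟩, fun a => (congrArg abs (DFunLike.congr_fun hfx a)).trans_le
    (hf' a), hfx⟩

/-- Hahn–Banach extension of a functional from a subspace of `c₀₀`, dominated by a pseudonorm. -/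
theorem exists_extension_le_extendNorm (μ : PseudonormSpace) (p : Submodule ℝ RealVec)
    (f : p →ₗ[ℝ] ℝ) (hf : ∀ x : p, f x ≤ extendNorm μ x) :
    ∃ g : RealVec →ₗ[ℝ] ℝ, (∀ x : p, g x = f x) ∧ ∀ x, g x ≤ extendNorm μ x :=
  exists_extension_of_le_sublinear ⟨p, f⟩ (extendNorm μ)
    (fun c hc x => by rw [map_smul_eq_mul, Real.norm_of_nonneg hc.le])
    (map_add_le_add _) hf

/-- The supremum over the dual ball that computes `μ a` is attained. -/
theorem exists_mem_dualBall_coordFunctional_apply_eq {μ : PseudonormSpace}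
    (hμ : ∀ x, extendNorm μ x = 0 → x = 0) (a : RealVec) :
    ∃ x ∈ dualBall μ, coordFunctional μ x a = extendNorm μ a := by
  rcases eq_or_ne a 0 with rfl | ha
  · exact ⟨0, zero_mem_dualBall μ, by simp⟩
  obtain ⟨g, hg, hgle⟩ := exists_extension_le_extendNorm μ (ℝ ∙ a)
    (extendNorm μ a • (LinearEquiv.toSpanNonzeroSingleton ℝ RealVec a ha).symm.toLinearMap) (by
      rintro ⟨y, hy⟩
      obtain ⟨c, rfl⟩ := Submodule.mem_span_singleton.1 hy
      have h : (LinearEquiv.toSpanNonzeroSingleton ℝ RealVec a ha).symm ⟨c • a, hy⟩ = c := by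
        rw [LinearEquiv.symm_apply_eq]; rfl
      simp only [LinearMap.smul_apply, LinearEquiv.coe_coe, h, smul_eq_mul, map_smul_eq_mul]
      rw [mul_comm]
      exact mul_le_mul_of_nonneg_right (le_abs_self c) (apply_nonneg _ _))
  obtain ⟨x, hx, hxg⟩ := exists_mem_dualBall_coordFunctional_eq hμ g hgle
  refine ⟨x, hx, ?_⟩
  have h : (LinearEquiv.toSpanNonzeroSingleton ℝ RealVec a ha).symm
      ⟨a, Submodule.mem_span_singleton_self a⟩ = 1 := by
    rw [LinearEquiv.symm_apply_eq]
    exact Subtype.ext (one_smul ℝ a).symm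
  rw [hxg]
  simpa [h] using hg ⟨a, Submodule.mem_span_singleton_self a⟩

/-- If `μ` and `ν` are `r`-close on the span of the first `n` basis vectors, then each point of
`dualBall μ` has a point of `dualBall ν` whose first `n` coordinates differ little from it: restrict
the functional to that span, divide it by `r` and extend it by Hahn–Banach. -/
theorem exists_mem_dualBall_near_of_le_mul {μ ν : PseudonormSpace}
    (hμ : ∀ x, extendNorm μ x = 0 → x = 0) (hν : ∀ x, extendNorm ν x = 0 → x = 0) {n : ℕ} {r : ℝ}
    (hr : 1 < r)
    (h₁ : ∀ x ∈ Finsupp.supported ℝ ℝ (Set.Iio n), extendNorm μ x ≤ r * extendNorm ν x)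
    (h₂ : ∀ x ∈ Finsupp.supported ℝ ℝ (Set.Iio n), extendNorm ν x ≤ r * extendNorm μ x)
    {y : EllTwo} (hy : y ∈ dualBall μ) :
    ∃ z ∈ dualBall ν, ∀ k < n, |y k - z k| ≤ 2 * (r - 1) * (1 / 4) ^ k := by
  have hr0 : 0 < r := by linarith
  obtain ⟨g, hg, hgle⟩ := exists_extension_le_extendNorm ν (Finsupp.supported ℝ ℝ (Set.Iio n))
    ((r⁻¹ • coordFunctional μ y).domRestrict _) (by
      rintro ⟨x, hx⟩
      change r⁻¹ * coordFunctional μ y x ≤ extendNorm ν x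
      rw [inv_mul_le_iff₀ hr0]
      exact ((le_abs_self _).trans (hy x)).trans (h₁ x hx))
  obtain ⟨z, hz, hzg⟩ := exists_mem_dualBall_coordFunctional_eq hν g hgle
  refine ⟨z, hz, fun k hk => ?_⟩
  have hk' : Finsupp.single k (1 : ℝ) ∈ Finsupp.supported ℝ ℝ (Set.Iio n) :=
    Finsupp.single_mem_supported ℝ 1 hk
  have hzk : coordWeight ν k * z k = r⁻¹ * (coordWeight μ k * y k) := by
    have h := hg ⟨_, hk'⟩
    rw [← hzg] at h
    simpa [coordFunctional_single] using h
  have hwμ := coordWeight_pos hμ k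
  have hwν := coordWeight_pos hν k
  have hw₁ : coordWeight μ k ≤ r * coordWeight ν k := by
    have h := h₁ _ hk'
    rw [extendNorm_single_one, extendNorm_single_one] at h
    rw [coordWeight, coordWeight, mul_left_comm]
    gcongr
  have hw₂ : coordWeight ν k ≤ r * coordWeight μ k := by
    have h := h₂ _ hk'
    rw [extendNorm_single_one, extendNorm_single_one] at h
    rw [coordWeight, coordWeight, mul_left_comm]
    gcongr
  set θ := coordWeight μ k / (r * coordWeight ν k) with hθ
  have hzθ : z k = θ * y k := by
    rw [hθ]; field_simp; field_simp at hzk; linarith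
  have hθ1 : θ ≤ 1 := (div_le_one (by positivity)).2 hw₁
  -- `θ ≥ r⁻²`, and `1 - r⁻² ≤ 2 (r - 1)`.
  have hθ2 : 1 - θ ≤ 2 * (r - 1) := by
    have h : 1 / r ^ 2 ≤ θ := by
      rw [hθ, div_le_div_iff₀ (by positivity) (by positivity)]
      nlinarith
    have h' : 1 - 2 * (r - 1) ≤ 1 / r ^ 2 := by
      rw [le_div_iff₀ (by positivity)]
      nlinarith [mul_pos (sub_pos.2 hr) (sub_pos.2 hr)]
    linarith
  have e : y k - z k = (1 - θ) * y k := by rw [hzθ]; ring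
  rw [e, abs_mul, abs_of_nonneg (by linarith)]
  exact mul_le_mul hθ2 (abs_coord_le_of_mem_dualBall hμ hy k) (abs_nonneg _) (by linarith)

/-- The dual balls depend continuously on the norm in the Hausdorff distance of `ℓ²`. -/
theorem eventually_dualBall_near {μ : PseudonormSpace} (hμ : ∀ x, extendNorm μ x = 0 → x = 0)
    {δ : ℝ} (hδ : 0 < δ) :
    ∀ᶠ ν in 𝓝 μ, (∀ x, extendNorm ν x = 0 → x = 0) →
      (∀ y ∈ dualBall μ, ∃ z ∈ dualBall ν, ‖y - z‖ ≤ δ) ∧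
        ∀ y ∈ dualBall ν, ∃ z ∈ dualBall μ, ‖y - z‖ ≤ δ := by
  obtain ⟨n, hn⟩ := exists_pow_lt_of_lt_one (show 0 < δ / 4 by positivity)
    (show (1 / 2 : ℝ) < 1 by norm_num)
  -- The first `n` coordinates are controlled by the norms, the others by the size of the dual ball.
  have main : ∀ {μ' ν' : PseudonormSpace}, (∀ x, extendNorm μ' x = 0 → x = 0) →
      (∀ x, extendNorm ν' x = 0 → x = 0) → ∀ y ∈ dualBall μ', ∀ z ∈ dualBall ν',
      (∀ k < n, |y k - z k| ≤ 2 * (1 + δ / 4 - 1) * (1 / 4) ^ k) → ‖y - z‖ ≤ δ := by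
    intro μ' ν' hμ' hν' y hy z hz h
    have := EllTwo.norm_le_of_geometric (x := y - z) (δ := δ / 2) (by positivity) fun k => ?_
    · linarith
    rcases lt_or_ge k n with hk | hk
    · refine (h k hk).trans ?_
      have := quarter_pow_le_half_pow k
      calc _ = δ / 2 * (1 / 4) ^ k := by ring
        _ ≤ _ := by gcongr
    · have h1 := abs_coord_le_of_mem_dualBall hμ' hy k
      have h2 := abs_coord_le_of_mem_dualBall hν' hz k
      have h3 : (1 / 4 : ℝ) ^ k = (1 / 2) ^ k * (1 / 2) ^ k := by rw [← mul_pow]; norm_num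
      have h4 : (1 / 2 : ℝ) ^ k ≤ δ / 4 :=
        (pow_le_pow_of_le_one (by norm_num) (by norm_num) hk).trans hn.le
      have h5 : (1 / 4 : ℝ) ^ k ≤ δ / 4 * (1 / 2) ^ k := by rw [h3]; gcongr
      calc |(y - z : EllTwo) k| ≤ |y k| + |z k| := abs_sub _ _
        _ ≤ δ / 2 * (1 / 2) ^ k := by linarith
  filter_upwards [eventually_extendNorm_le_mul hμ n (show 1 < 1 + δ / 4 by linarith)] with ν h hν
  constructor
  · intro y hy
    obtain ⟨z, hz, hyz⟩ := exists_mem_dualBall_near_of_le_mul hμ hν (by linarith)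
      (fun x hx => (h x hx).2) (fun x hx => (h x hx).1) hy
    exact ⟨z, hz, main hμ hν y hy z hz hyz⟩
  · intro y hy
    obtain ⟨z, hz, hyz⟩ := exists_mem_dualBall_near_of_le_mul hν hμ (by linarith)
      (fun x hx => (h x hx).1) (fun x hx => (h x hx).2) hy
    exact ⟨z, hz, main hν hμ y hy z hz hyz⟩

/-! ### Nearest points in convex sets -/

/-- Nearest points to `x` in two convex sets at Hausdorff distance at most `δ` are at distance
`O(√δ)`; the nearest points are described by their variational inequalities. -/
theorem norm_sub_sq_le_of_variational {E : Type*} [NormedAddCommGroup E] [InnerProductSpace ℝ E]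
    {x p q y z : E} {R δ : ℝ} (hp : ⟪x - p, y - p⟫_ℝ ≤ 0) (hq : ⟪x - q, z - q⟫_ℝ ≤ 0)
    (hxp : ‖x - p‖ ≤ R) (hxq : ‖x - q‖ ≤ R) (hy : ‖q - y‖ ≤ δ) (hz : ‖p - z‖ ≤ δ) :
    ‖p - q‖ ^ 2 ≤ 2 * (R * δ) := by
  have hR : 0 ≤ R := (norm_nonneg _).trans hxp
  have h1 : ⟪x - p, q - y⟫_ℝ ≤ R * δ :=
    (real_inner_le_norm _ _).trans (mul_le_mul hxp hy (norm_nonneg _) hR)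
  have h2 : ⟪x - q, p - z⟫_ℝ ≤ R * δ :=
    (real_inner_le_norm _ _).trans (mul_le_mul hxq hz (norm_nonneg _) hR)
  have e1 : ⟪x - p, q - p⟫_ℝ = ⟪x - p, q - y⟫_ℝ + ⟪x - p, y - p⟫_ℝ := by
    rw [← inner_add_right, sub_add_sub_cancel]
  have e2 : ⟪x - q, p - q⟫_ℝ = ⟪x - q, p - z⟫_ℝ + ⟪x - q, z - q⟫_ℝ := by
    rw [← inner_add_right, sub_add_sub_cancel]
  have e3 : ‖p - q‖ ^ 2 = ⟪x - p, q - p⟫_ℝ + ⟪x - q, p - q⟫_ℝ := by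
    rw [← neg_sub p q, inner_neg_right, ← real_inner_self_eq_norm_sq, neg_add_eq_sub,
      ← inner_sub_left]
    congr 1
    abel
  linarith

theorem exists_nearestPoint (μ : PseudonormSpace) (x : EllTwo) :
    ∃ p ∈ dualBall μ, ∀ y ∈ dualBall μ, ⟪x - p, y - p⟫_ℝ ≤ 0 := by
  obtain ⟨p, hp, h⟩ := exists_norm_eq_iInf_of_complete_convex ⟨0, zero_mem_dualBall μ⟩
    (isClosed_dualBall μ).isComplete (convex_dualBall μ) x
  exact ⟨p, hp, (norm_eq_iInf_iff_real_inner_le_zero (convex_dualBall μ) hp).1 h⟩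

/-- The point of `dualBall μ` nearest to `x`. -/
noncomputable def nearestPoint (μ : PseudonormSpace) (x : EllTwo) : EllTwo :=
  (exists_nearestPoint μ x).choose

theorem nearestPoint_mem (μ : PseudonormSpace) (x : EllTwo) : nearestPoint μ x ∈ dualBall μ :=
  (exists_nearestPoint μ x).choose_spec.1

theorem inner_nearestPoint_le_zero {μ : PseudonormSpace} (x : EllTwo) {y : EllTwo}
    (hy : y ∈ dualBall μ) : ⟪x - nearestPoint μ x, y - nearestPoint μ x⟫_ℝ ≤ 0 :=
  (exists_nearestPoint μ x).choose_spec.2 y hy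

theorem nearestPoint_of_mem {μ : PseudonormSpace} {x : EllTwo} (hx : x ∈ dualBall μ) :
    nearestPoint μ x = x := by
  have h := inner_nearestPoint_le_zero x hx
  rw [real_inner_self_eq_norm_sq] at h
  have h0 : ‖x - nearestPoint μ x‖ = 0 :=
    (pow_eq_zero_iff two_ne_zero).1 (le_antisymm h (sq_nonneg _))
  exact (sub_eq_zero.1 (norm_eq_zero.1 h0)).symm

/-- The nearest point map depends continuously on the norm, uniformly on the ball of radius `2`. -/
theorem eventually_nearestPoint_near (μ : normSpace) {ε : ℝ} (hε : 0 < ε) :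
    ∀ᶠ ν : normSpace in 𝓝 μ, ∀ x : EllTwo, ‖x‖ ≤ 2 →
      ‖nearestPoint ν.1 x - nearestPoint μ.1 x‖ ≤ ε := by
  have h := eventually_dualBall_near μ.2.2 (δ := ε ^ 2 / 8) (by positivity)
  filter_upwards [continuous_subtype_val.continuousAt.eventually h] with ν hν x hx
  obtain ⟨h1, h2⟩ := hν ν.2.2
  obtain ⟨y, hy, hy'⟩ := h1 _ (nearestPoint_mem μ.1 x)
  obtain ⟨z, hz, hz'⟩ := h2 _ (nearestPoint_mem ν.1 x)
  have hball : ∀ ν : normSpace, ‖x - nearestPoint ν.1 x‖ ≤ 4 := fun ν => by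
    have := norm_le_two_of_mem_dualBall ν.2.2 (nearestPoint_mem ν.1 x)
    linarith [norm_sub_le x (nearestPoint ν.1 x)]
  refine le_of_sq_le_sq ?_ hε.le
  refine (norm_sub_sq_le_of_variational (inner_nearestPoint_le_zero x hy)
    (inner_nearestPoint_le_zero x hz) (hball ν) (hball μ) hy' hz').trans_eq ?_
  ring

/-! ### Continuous isometric copies of all norms in one space of bounded functions -/

/-- The space of bounded real functions on the ball of radius `2` of `ℓ²`, a ball that contains
`dualBall μ` for every norm `μ`. -/
abbrev BallFunctions : Type := lp (fun _ : Metric.closedBall (0 : EllTwo) 2 => ℝ) ⊤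

theorem abs_nearestPoint_coord_le_one (μ : normSpace) (x : EllTwo) (k : ℕ) :
    |nearestPoint μ.1 x k| ≤ 1 :=
  (abs_coord_le_of_mem_dualBall μ.2.2 (nearestPoint_mem μ.1 x) k).trans
    (pow_le_one₀ (by norm_num) (by norm_num))

/-- The image of `e_k` under the isometric embedding of `(c₀₀, μ)`: the evaluation at `e_k` of the
functional in the dual ball nearest to `x`, as a function of `x`. -/
noncomputable def basisImage (k : ℕ) (μ : normSpace) : BallFunctions :=
  ⟨fun x => coordWeight μ.1 k * nearestPoint μ.1 x k, memℓp_infty ⟨coordWeight μ.1 k, by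
    rintro _ ⟨x, rfl⟩
    have h := mul_le_mul_of_nonneg_left (abs_nearestPoint_coord_le_one μ x k)
      (coordWeight_pos μ.2.2 k).le
    simpa [abs_mul, abs_of_pos (coordWeight_pos μ.2.2 k)] using h⟩⟩

theorem basisImage_apply (k : ℕ) (μ : normSpace) (x : Metric.closedBall (0 : EllTwo) 2) :
    basisImage k μ x = coordWeight μ.1 k * nearestPoint μ.1 x k :=
  rfl

theorem linearCombination_basisImage_apply (μ : normSpace) (a : RealVec)
    (x : Metric.closedBall (0 : EllTwo) 2) :
    Finsupp.linearCombination ℝ (fun k => basisImage k μ) a x =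
      coordFunctional μ.1 (nearestPoint μ.1 x) a := by
  rw [Finsupp.linearCombination_apply, coordFunctional_apply, Finsupp.sum, Finsupp.sum,
    lp.coeFn_sum, Finset.sum_apply]
  rfl

/-- The functions `basisImage k μ` span an isometric copy of `(c₀₀, μ)`, since the nearest points
fill the dual ball. -/
theorem norm_linearCombination_basisImage (μ : normSpace) (a : RealVec) :
    ‖Finsupp.linearCombination ℝ (fun k => basisImage k μ) a‖ = extendNorm μ.1 a := by
  apply le_antisymm
  · refine lp.norm_le_of_forall_le (apply_nonneg _ _) fun x => ?_
    rw [linearCombination_basisImage_apply]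
    exact nearestPoint_mem μ.1 x a
  · obtain ⟨x, hx, hxa⟩ := exists_mem_dualBall_coordFunctional_apply_eq μ.2.2 a
    have hx2 : x ∈ Metric.closedBall (0 : EllTwo) 2 := by
      simpa using norm_le_two_of_mem_dualBall μ.2.2 hx
    have h := lp.norm_apply_le_norm ENNReal.top_ne_zero
      (Finsupp.linearCombination ℝ (fun k => basisImage k μ) a) ⟨x, hx2⟩
    rw [linearCombination_basisImage_apply, nearestPoint_of_mem hx, hxa] at h
    exact (le_abs_self _).trans h

theorem continuous_basisImage (k : ℕ) : Continuous (basisImage k) := by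
  rw [continuous_iff_continuousAt]
  intro μ
  rw [ContinuousAt, Metric.tendsto_nhds]
  intro ε hε
  have hw := coordWeight_pos μ.2.2 k
  have hc : Continuous fun ν : normSpace => |coordWeight ν.1 k - coordWeight μ.1 k| :=
    ((continuous_const.mul ((continuous_pseudonorm_apply _).comp continuous_subtype_val)).sub
      continuous_const).abs
  filter_upwards [eventually_nearestPoint_near μ (show 0 < ε / 3 / coordWeight μ.1 k by positivity),
    hc.continuousAt.eventually_lt_const (show _ < ε / 3 by simpa using hε)] with ν h1 h2
  have hle : dist (basisImage k ν) (basisImage k μ) ≤ ε / 3 + ε / 3 := by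
    rw [dist_eq_norm]
    refine lp.norm_le_of_forall_le (by positivity) fun x => ?_
    have h3 := h1 x (mem_closedBall_zero_iff.1 x.2)
    have h4 := (lp.norm_apply_le_norm (by norm_num)
      (nearestPoint ν.1 x - nearestPoint μ.1 x) k).trans h3
    have e : (basisImage k ν - basisImage k μ : BallFunctions) x =
        (coordWeight ν.1 k - coordWeight μ.1 k) * nearestPoint ν.1 x k +
          coordWeight μ.1 k * (nearestPoint ν.1 x - nearestPoint μ.1 x : EllTwo) k := by
      change coordWeight ν.1 k * nearestPoint ν.1 x k - coordWeight μ.1 k * nearestPoint μ.1 x k =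
        (coordWeight ν.1 k - coordWeight μ.1 k) * nearestPoint ν.1 x k +
          coordWeight μ.1 k * (nearestPoint ν.1 x k - nearestPoint μ.1 x k)
      ring
    rw [e]
    refine (norm_add_le _ _).trans (add_le_add ?_ ?_)
    · rw [norm_mul]
      exact (mul_le_of_le_one_right (norm_nonneg _) (abs_nearestPoint_coord_le_one ν x k)).trans
        h2.le
    · rw [norm_mul, Real.norm_of_nonneg hw.le, ← le_div_iff₀' hw]
      exact h4
  linarith

instance : SecondCountableTopology PseudonormSpace :=
  (IsInducing.mk rfl : IsInducing fun (μ : PseudonormSpace) (v : RatVec) =>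
    μ v).secondCountableTopology

/-- The norms embed isometrically and continuously into every isometrically universal space: the
functions `basisImage k μ` all lie in one separable space of bounded functions. -/
theorem exists_continuous_isometric_copies {X : Type*} [NormedAddCommGroup X] [NormedSpace ℝ X]
    (hX : IsometricallyUniversal X) :
    ∃ χ : ℕ → normSpace → X, (∀ k, Continuous (χ k)) ∧ ∀ (ν : normSpace) (a : RealVec),
      ‖Finsupp.linearCombination ℝ (fun k => χ k ν) a‖ = extendNorm ν.1 a := by
  let S : Set BallFunctions := ⋃ k, Set.range (basisImage k)
  have hS : TopologicalSpace.IsSeparable S :=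
    .iUnion fun k => TopologicalSpace.isSeparable_range (continuous_basisImage k)
  let Y : Submodule ℝ BallFunctions := (Submodule.span ℝ S).topologicalClosure
  have hY : TopologicalSpace.IsSeparable (Y : Set BallFunctions) := hS.span.closure
  have : TopologicalSpace.SeparableSpace Y := hY.separableSpace
  have : CompleteSpace Y := (Submodule.isClosed_topologicalClosure _).completeSpace_coe
  have hmem : ∀ k ν, basisImage k ν ∈ Y := fun k ν =>
    Submodule.le_topologicalClosure _ (Submodule.subset_span (Set.mem_iUnion.2 ⟨k, ν, rfl⟩))
  obtain ⟨J⟩ := hX Y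
  refine ⟨fun k ν => J ⟨basisImage k ν, hmem k ν⟩, fun k =>
    J.continuous.comp ((continuous_basisImage k).subtype_mk _), fun ν a => ?_⟩
  have h1 : Finsupp.linearCombination ℝ (fun k => J ⟨basisImage k ν, hmem k ν⟩) a =
      J (Finsupp.linearCombination ℝ (fun k => (⟨basisImage k ν, hmem k ν⟩ : Y)) a) :=
    (Finsupp.apply_linearCombination ℝ J.toLinearMap _ a).symm
  have h2 : (Finsupp.linearCombination ℝ (fun k => (⟨basisImage k ν, hmem k ν⟩ : Y)) a :
      BallFunctions) = Finsupp.linearCombination ℝ (fun k => basisImage k ν) a :=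
    Finsupp.apply_linearCombination ℝ Y.subtype _ a
  rw [h1, J.norm_map, ← norm_linearCombination_basisImage, ← h2]
  rfl

/-! ### Countable unions of closed sets -/

theorem IsSigmaTwo.sUnion {A : Type*} [TopologicalSpace A] {S : Set (Set A)} (hS : S.Countable)
    (h : ∀ s ∈ S, IsSigmaTwo s) : IsSigmaTwo (⋃₀ S) := by
  rcases S.eq_empty_or_nonempty with rfl | hne
  · exact ⟨fun _ => ∅, fun _ => isClosed_empty, by simp⟩
  obtain ⟨f, rfl⟩ := hS.exists_eq_range hne
  choose F hF hFf using fun n => h (f n) ⟨n, rfl⟩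
  refine ⟨fun n => F n.unpair.1 n.unpair.2, fun n => hF _ _, ?_⟩
  rw [Set.iUnion_unpair F, Set.sUnion_range]
  exact Set.iUnion_congr hFf

theorem IsSigmaTwo.inter {A : Type*} [TopologicalSpace A] {s t : Set A} (hs : IsSigmaTwo s)
    (ht : IsSigmaTwo t) : IsSigmaTwo (s ∩ t) := by
  obtain ⟨F, hF, rfl⟩ := hs
  obtain ⟨G, hG, rfl⟩ := ht
  refine ⟨fun n => F n.unpair.1 ∩ G n.unpair.2, fun n => (hF _).inter (hG _), ?_⟩
  rw [Set.iUnion_unpair fun i j => F i ∩ G j, Set.iUnion_inter_iUnion]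

theorem IsClosed.isSigmaTwo {A : Type*} [TopologicalSpace A] {s : Set A} (hs : IsClosed s) :
    IsSigmaTwo s :=
  ⟨fun _ => s, fun _ => hs, (Set.iUnion_const s).symm⟩

theorem IsOpen.isSigmaTwo {A : Type*} [TopologicalSpace A]
    [TopologicalSpace.PseudoMetrizableSpace A] {s : Set A} (hs : IsOpen s) : IsSigmaTwo s := by
  let := TopologicalSpace.pseudoMetrizableSpacePseudoMetric A
  obtain ⟨F, hF, -, hs', -⟩ := hs.exists_iUnion_isClosed
  exact ⟨F, hF, hs'.symm⟩

theorem IsSigmaTwo.sInter {A : Type*} [TopologicalSpace A] {S : Set (Set A)} (hS : S.Finite)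
    (h : ∀ s ∈ S, IsSigmaTwo s) : IsSigmaTwo (⋂₀ S) := by
  induction S, hS using Set.Finite.induction_on with
  | empty => simpa using isClosed_univ.isSigmaTwo
  | insert _ _ ih =>
    rw [Set.sInter_insert]
    exact (h _ (Set.mem_insert _ _)).inter (ih fun s hs => h s (Set.mem_insert_of_mem _ hs))

/-- A map into `𝓕(X)` for which hitting an open set is an open condition is `Σ⁰₂`-measurable for
every admissible topology: the preimages of the subbasic sets are countable unions of differences
of open sets, and by second countability an open set is a countable union of finite intersections
of subbasic sets. -/
theorem IsAdmissible.sigmaTwoMeasurable {X A : Type*} [TopologicalSpace X] [TopologicalSpace A]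
    [TopologicalSpace.PseudoMetrizableSpace A] {σ : TopologicalSpace (ClosedSets X)}
    (hσ : IsAdmissible σ) {f : A → ClosedSets X}
    (hf : ∀ U : Set X, IsOpen U → IsOpen (f ⁻¹' hitSet U)) : SigmaTwoMeasurable σ f := by
  obtain ⟨S, hS, hSU⟩ := hσ.exists_subbasis
  have hsub : ∀ s ∈ S, IsSigmaTwo (f ⁻¹' s) := by
    intro s hs
    obtain ⟨U, W, hU, hW, rfl⟩ := hSU s hs
    rw [Set.preimage_iUnion, ← Set.sUnion_range]
    refine IsSigmaTwo.sUnion (Set.countable_range _) ?_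
    rintro _ ⟨n, rfl⟩
    exact (hf _ (hU n)).isSigmaTwo.inter (hf _ (hW n)).isClosed_compl.isSigmaTwo
  intro O hO
  let := σ
  have := hσ.polish
  have hB := TopologicalSpace.isTopologicalBasis_of_subbasis hS
  obtain ⟨B, hBS, rfl⟩ := hB.open_eq_sUnion hO
  obtain ⟨T, hT, hTB, hTeq⟩ :=
    TopologicalSpace.isOpen_sUnion_countable B fun s hs => hB.isOpen (hBS hs)
  rw [← hTeq, Set.preimage_sUnion, ← Set.sUnion_image]
  refine IsSigmaTwo.sUnion (hT.image _) ?_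
  rintro _ ⟨t, ht, rfl⟩
  obtain ⟨Q, ⟨hQ, hQS⟩, rfl⟩ := hBS (hTB ht)
  dsimp only
  rw [Set.preimage_sInter, ← Set.sInter_image]
  refine IsSigmaTwo.sInter (hQ.image _) ?_
  rintro _ ⟨q, hq, rfl⟩
  exact hsub q (hQS hq)

/-! ### Embedding the coded space -/

/-- The canonical map from `c₀₀` to the Banach space `X_μ`. -/
noncomputable def toCodedSpace (μ : PseudonormSpace) : RealVec →ₗ[ℝ] CodedSpace μ :=
  (UniformSpace.Completion.toComplL (𝕜 := ℝ) (E := PreSpace μ)).toLinearMap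

theorem norm_toCodedSpace (μ : PseudonormSpace) (a : RealVec) :
    ‖toCodedSpace μ a‖ = extendNorm μ a :=
  UniformSpace.Completion.norm_coe (E := PreSpace μ) a

theorem denseRange_toCodedSpace (μ : PseudonormSpace) : DenseRange (toCodedSpace μ) :=
  UniformSpace.Completion.denseRange_coe (α := PreSpace μ)

/-- A linear map on `c₀₀` that turns `μ` into the norm extends to an isometric embedding
of `X_μ`. -/
theorem exists_linearIsometry_codedSpace {X : Type*} [NormedAddCommGroup X] [NormedSpace ℝ X]
    [CompleteSpace X] {μ : PseudonormSpace} (T : RealVec →ₗ[ℝ] X)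
    (hT : ∀ a, ‖T a‖ = extendNorm μ a) :
    ∃ J : CodedSpace μ →ₗᵢ[ℝ] X, ∀ a, J (toCodedSpace μ a) = T a := by
  have hT' : ∀ a, ‖T a‖ = ‖toCodedSpace μ a‖ := fun a => (hT a).trans (norm_toCodedSpace μ a).symm
  let L : CodedSpace μ →L[ℝ] X := T.extendOfNorm (toCodedSpace μ)
  have hL : ∀ a, L (toCodedSpace μ a) = T a :=
    LinearMap.extendOfNorm_eq (denseRange_toCodedSpace μ) ⟨1, fun a => by rw [hT', one_mul]⟩
  refine ⟨{ toLinearMap := L.toLinearMap, norm_map' := fun x => ?_ }, hL⟩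
  refine (denseRange_toCodedSpace μ).induction_on x
    (isClosed_eq L.continuous.norm continuous_norm) fun a => ?_
  exact (congrArg norm (hL a)).trans (hT' a)

theorem denseRange_toCodedSpace_ratToReal (μ : PseudonormSpace) :
    DenseRange fun v : RatVec => toCodedSpace μ (ratToReal v) := by
  refine Metric.denseRange_iff.2 fun x ε hε => ?_
  obtain ⟨a, ha⟩ := (denseRange_toCodedSpace μ).exists_dist_lt x (half_pos hε)
  obtain ⟨v, hv⟩ := exists_ratToReal_near (extendNorm μ) a (ε / 2) (half_pos hε)
  rw [← norm_toCodedSpace, map_sub, ← dist_eq_norm] at hv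
  exact ⟨v, (dist_triangle _ _ _).trans_lt ((add_lt_add ha hv).trans_eq (add_halves ε))⟩

instance : TopologicalSpace.PseudoMetrizableSpace PseudonormSpace :=
  (IsInducing.mk rfl : IsInducing fun (μ : PseudonormSpace) (v : RatVec) =>
    μ v).pseudoMetrizableSpace

theorem mainTheorem1 {X : Type*} [NormedAddCommGroup X] [NormedSpace ℝ X] [CompleteSpace X]
    [TopologicalSpace.SeparableSpace X] (hX : IsometricallyUniversal X) :
    (∀ τ : TopologicalSpace (SB X), IsAdmissibleSB τ →
      ∃ Φ : normSpace → SB X, SigmaTwoMeasurable τ Φ ∧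
        ∀ μ : normSpace, Nonempty (CodedSpace μ.1 ≃ₗᵢ[ℝ] (Φ μ).toSubmodule)) ∧
    ∃ χ : ℕ → normSpace → X, (∀ k, Continuous (χ k)) ∧
      ∀ (ν : normSpace) (a : RealVec),
        ‖a.sum fun k c => c • χ k ν‖ = extendNorm ν.1 a := by
  obtain ⟨χ, hχ, hnorm⟩ := exists_continuous_isometric_copies hX
  refine ⟨?_, χ, hχ, hnorm⟩
  rintro _ ⟨σ, hσ, rfl⟩
  choose J hJ using fun μ : normSpace => exists_linearIsometry_codedSpace
    (Finsupp.linearCombination ℝ fun k => χ k μ) (hnorm μ)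
  let Φ : normSpace → SB X := fun μ =>
    { toSubmodule := (J μ).range
      isClosed' := (J μ).isometry.isClosedEmbedding.isClosed_range }
  refine ⟨Φ, ?_, fun μ => ⟨(J μ).equivRange⟩⟩
  have hhit : ∀ U : Set X, IsOpen U → IsOpen ((SB.toClosedSets ∘ Φ) ⁻¹' hitSet U) := by
    intro U hU
    -- By density of `V` it suffices to look for points of `U` among the rational combinations.
    have e : (SB.toClosedSets ∘ Φ) ⁻¹' hitSet U = ⋃ v : RatVec,
        {μ | Finsupp.linearCombination ℝ (fun k => χ k μ) (ratToReal v) ∈ U} := by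
      ext μ
      rw [Set.mem_iUnion]
      constructor
      · rintro ⟨_, hy, x, rfl⟩
        obtain ⟨v, hv⟩ := (denseRange_toCodedSpace_ratToReal μ.1).exists_mem_open
          (hU.preimage (J μ).continuous) ⟨x, hy⟩
        exact ⟨v, (congrArg (· ∈ U) (hJ μ (ratToReal v))).mp hv⟩
      · rintro ⟨v, hv⟩
        exact ⟨_, hv, _, hJ μ (ratToReal v)⟩
    rw [e]
    refine isOpen_iUnion fun v => hU.preimage ?_
    simp only [Finsupp.linearCombination_apply, Finsupp.sum]
    exact continuous_finsetSum _ fun k _ => (hχ k).const_smul _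
  rintro _ ⟨O, hO, rfl⟩
  exact hσ.sigmaTwoMeasurable hhit O hO
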